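/- Let $\mathscr P=(A,b,c)$, with $A\in\mathbb R^{n\times n}$, $b\in\mathbb R^{n\times 1}$, $c\in\mathbb R^{1\times n}$, be a minimal single-input single-output linear time-invariant system, i.e. no real system with fewer than $n$ states has the same transfer function $H(s)=c(sI-A)^{-1}b$. A complex square matrix is called Hurwitz if all its eigenvalues lie in the open left half plane. For $k\in\mathbb R$ the synchronization region is $$\mathcal S_{\mathscr P,k}=\{s\in\mathbb C : A-s\,k\,bc \text{ is Hurwitz}\}.$$ The Nyquist contour is the oriented closed curve $\gamma:[-\infty,\infty]\to\mathbb C$, $\gamma(\omega)=H(i\omega)$, $\gamma(\pm\infty)=0$. The winding number $w(\gamma,s)$ is the number of counterclockwise rotations of $\gamma$ around $s$; it is defined when $s$ does not lie on $\gamma$. If $H$ has poles $i\omega_j$ on the imaginary axis, then for small $\epsilon>0$ let $$\gamma_\epsilon(\omega)=\begin{cases}H\bigl(i\omega_j+\epsilon e^{\frac{i\pi}{2\epsilon}(\omega-\omega_j)}\bigr), & |\omega-\omega_j|<\epsilon \text{ for some } j,\\ H(i\omega), & \text{otherwise},\end{cases}\qquad \gamma_\epsilon(\pm\infty)=0,$$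 and $w(\gamma,s):=\lim_{\epsilon\to0^+}w(\gamma_\epsilon,s)$, which is defined when $s$ does not lie on $\gamma_\epsilon$ for all sufficiently small $\epsilon>0$ and the limit exists. The stable Nyquist region is $$\mathcal N_{\mathscr P}=\{s\in\mathbb C : w(\gamma,s)\text{ is defined and } w(\gamma,s)=p^+\},$$ where $p^+$ is the number of poles of $H$ in the open right half plane, counted with multiplicity. Then for every real $k\neq0$, $$\mathcal S_{\mathscr P,k}\setminus\{0\}=\Bigl\{-\frac1{sk} : s\in\mathcal N_{\mathscr P}\setminus\{0\}\Bigr\}.$$ -/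

import Mathlib

open Filter Topology

noncomputable section

/-- A real linear time-invariant system `x' = A x + B u`, `y = C x`, with `n` states, `m` inputs
and `q` outputs. -/
structure LTISystem (n m q : ℕ) where
  A : Matrix (Fin n) (Fin n) ℝ
  B : Matrix (Fin n) (Fin m) ℝ
  C : Matrix (Fin q) (Fin n) ℝ

/-- A complex square matrix is Hurwitz if its eigenvalues have negative real part. -/
def IsHurwitz {n : ℕ} (M : Matrix (Fin n) (Fin n) ℂ) : Prop :=
  ∀ z ∈ spectrum ℂ M, z.re < 0

/-- `f` has a pole at `z`. -/
def IsPole (f : ℂ → ℂ) (z : ℂ) : Prop :=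
  meromorphicOrderAt f z < 0

/-- The order of `z` as a pole of `f`, which is `0` if `z` is not a pole. -/
def poleOrder (f : ℂ → ℂ) (z : ℂ) : ℕ :=
  (-(meromorphicOrderAt f z).untop₀).toNat

/-- The closed curve `γ : [-∞, ∞] → ℂ` does not pass through `s`, and its winding number around
`s` (the number of its counterclockwise turns) is `w`: a continuous choice `θ` of the argument of
`γ - s` along the curve increases by `2 π w` in total. -/
def IsWindingNumber (γ : EReal → ℂ) (s : ℂ) (w : ℤ) : Prop :=
  Continuous γ ∧ γ ⊥ = γ ⊤ ∧ (∀ ω, γ ω ≠ s) ∧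
    ∃ θ : EReal → ℝ, Continuous θ ∧
      (∀ ω, γ ω - s = ‖γ ω - s‖ * Complex.exp (Complex.I * θ ω)) ∧
      θ ⊤ - θ ⊥ = 2 * Real.pi * w

namespace LTISystem

/-- The synchronization region: all complex `s` for which `A - s B K C` is Hurwitz. -/
def syncRegion {n m q : ℕ} (P : LTISystem n m q) (K : Matrix (Fin m) (Fin q) ℝ) : Set ℂ :=
  {s | IsHurwitz (P.A.map Complex.ofReal - s • (P.B * K * P.C).map Complex.ofReal)}

/-- The transfer function `H(s) = c (s I - A)⁻¹ b` of a single-input single-output system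
(the value at an eigenvalue of `A` is irrelevant). -/
def transferFunction {n : ℕ} (P : LTISystem n 1 1) (s : ℂ) : ℂ :=
  (P.C.map Complex.ofReal * (s • (1 : Matrix (Fin n) (Fin n) ℂ) - P.A.map Complex.ofReal)⁻¹ *
    P.B.map Complex.ofReal) 0 0

/-- Two single-input single-output systems, possibly with different numbers of states, realize the
same transfer function: the transfer functions agree wherever both resolvents exist. -/
def SameTransferFunction {n n' : ℕ} (P : LTISystem n 1 1) (P' : LTISystem n' 1 1) : Prop :=
  ∀ s : ℂ, s ∉ spectrum ℂ (P.A.map Complex.ofReal) → s ∉ spectrum ℂ (P'.A.map Complex.ofReal) →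
    P.transferFunction s = P'.transferFunction s

/-- A system is minimal if no system with fewer states has the same transfer function. -/
def IsMinimal {n : ℕ} (P : LTISystem n 1 1) : Prop :=
  ∀ (n' : ℕ) (P' : LTISystem n' 1 1), P.SameTransferFunction P' → n ≤ n'

/-- The number of poles of the transfer function in the open right half plane, counted with
multiplicity. -/
def numUnstablePoles {n : ℕ} (P : LTISystem n 1 1) : ℕ :=
  ∑ᶠ z ∈ {z : ℂ | 0 < z.re}, poleOrder P.transferFunction z

open Classical in
/-- The point of the indented imaginary axis at the real frequency `ω`: it is `i ω`, except that
within distance `ε` of a pole `i ω₀` the axis is replaced by the half circle of radius `ε` around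
`i ω₀` in the right half plane. (For small `ε` there is at most one such `ω₀`.) -/
def indentedAxis {n : ℕ} (P : LTISystem n 1 1) (ε ω : ℝ) : ℂ :=
  if h : ∃ ω₀ : ℝ, IsPole P.transferFunction (Complex.I * ω₀) ∧ |ω - ω₀| < ε then
    Complex.I * h.choose +
      ε * Complex.exp (Complex.I * Real.pi / (2 * ε) * (ω - h.choose))
  else Complex.I * ω

open Classical in
/-- The Nyquist contour `[-∞, ∞] → ℂ`, `ω ↦ H(i ω)`, indented with radius `ε` at the poles on the
imaginary axis, and extended by continuity by `0` at `±∞`. If there is no pole on the imaginary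
axis this is the Nyquist contour itself, for every `ε`. -/
def nyquistContour {n : ℕ} (P : LTISystem n 1 1) (ε : ℝ) (ω : EReal) : ℂ :=
  if ω = ⊥ ∨ ω = ⊤ then 0 else P.transferFunction (P.indentedAxis ε ω.toReal)

/-- The winding number of the Nyquist contour around `s` is defined and equals `w`: it is the limit
of the winding numbers of the indented contours as `ε → 0⁺`. -/
def IsNyquistWindingNumber {n : ℕ} (P : LTISystem n 1 1) (s : ℂ) (w : ℤ) : Prop :=
  ∃ v : ℝ → ℤ, (∀ᶠ ε in 𝓝[>] (0 : ℝ), IsWindingNumber (P.nyquistContour ε) s (v ε)) ∧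
    Tendsto v (𝓝[>] 0) (𝓝 w)

/-- The stable Nyquist region. -/
def stableNyquistRegion {n : ℕ} (P : LTISystem n 1 1) : Set ℂ :=
  {s | P.IsNyquistWindingNumber s P.numUnstablePoles}

end LTISystem

end

noncomputable section

/-! ### Continuity on the extended real line -/

/-! Write `H = q/p` with `p = det(z - A)` and `q = det(z - A + bc) - p`. By the matrix determinant
lemma `A - t bc` has characteristic polynomial `p + t q`; for `t = sk = -1/σ` this is `-(1/σ)(q - σ
p)`. Hence `s = -1/(σk)` lies in the synchronization region iff all roots of `q - σ p` have negative
real part (`mem_syncRegion_iff`). The Nyquist criterion `IsMinimal.mem_stableNyquistRegion_iff` says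
the same of `σ` in the stable Nyquist region.

For the criterion, minimality makes `q` and `p` coprime (`IsMinimal.isCoprime`), so the poles of `H`
are the roots of `p` with multiplicity. Along the indented axis, `H - σ = (q - σ p)/p` is `-σ` times
a quotient of two products of `n` factors `(z - a)/(z + 1)`. Instead of the argument principle,
explicit arguments show that a factor winds `-1` times around `0` if `a` is to the right of the
curve and `0` times if it is to the left. Multiplicativity gives winding number `p⁺ - Z`, where `Z`
counts the roots of `q - σ p` in the open right half plane; it equals `p⁺` iff `Z = 0`. Roots on the
axis itself are excluded because the contour would then pass through `σ`. -/

/-- A function on the extended real line is continuous as soon as its restriction to the real line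
is continuous and has the right limits at `±∞`. -/
theorem EReal.continuous_of_tendsto {X : Type*} [TopologicalSpace X] {f : EReal → X}
    (hf : Continuous fun x : ℝ => f x) (htop : Tendsto (fun x : ℝ => f x) atTop (𝓝 (f ⊤)))
    (hbot : Tendsto (fun x : ℝ => f x) atBot (𝓝 (f ⊥))) : Continuous f := by
  refine continuous_iff_continuousAt.2 fun x => ?_
  induction x with
  | bot =>
    intro s hs
    have h := hbot hs
    rw [mem_map, mem_atBot_sets] at h
    obtain ⟨a, ha⟩ := h
    refine EReal.mem_nhds_bot_iff.2 ⟨a, fun y hy => ?_⟩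
    induction y with
    | bot => exact show f ⊥ ∈ s from mem_of_mem_nhds hs
    | coe y => exact ha y (EReal.coe_lt_coe_iff.1 hy).le
    | top => exact absurd hy (by simp)
  | coe x =>
    rw [ContinuousAt, EReal.nhds_coe, tendsto_map'_iff]
    exact hf.tendsto x
  | top =>
    intro s hs
    have h := htop hs
    rw [mem_map, mem_atTop_sets] at h
    obtain ⟨a, ha⟩ := h
    refine EReal.mem_nhds_top_iff.2 ⟨a, fun y hy => ?_⟩
    induction y with
    | top => exact show f ⊤ ∈ s from mem_of_mem_nhds hs
    | coe y => exact ha y (EReal.coe_lt_coe_iff.1 hy).le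
    | bot => exact absurd hy (by simp)

/-! ### Winding numbers of closed curves on the extended real line -/

namespace IsWindingNumber

theorem sub_iff {γ : EReal → ℂ} {s : ℂ} {w : ℤ} :
    IsWindingNumber γ s w ↔ IsWindingNumber (fun ω => γ ω - s) 0 w := by
  unfold IsWindingNumber
  simp only [sub_zero, sub_left_inj, ne_eq, sub_eq_zero]
  refine and_congr ⟨fun h => h.sub continuous_const, fun h => ?_⟩ Iff.rfl
  exact (h.add continuous_const).congr fun ω => sub_add_cancel (γ ω) s

theorem mul {f g : EReal → ℂ} {v w : ℤ} (hf : IsWindingNumber f 0 v)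
    (hg : IsWindingNumber g 0 w) : IsWindingNumber (fun ω => f ω * g ω) 0 (v + w) := by
  obtain ⟨cf, ef, nf, θ, cθ, hθ, dθ⟩ := hf
  obtain ⟨cg, eg, ng, φ, cφ, hφ, dφ⟩ := hg
  refine ⟨cf.mul cg, by simp only [ef, eg], fun ω => mul_ne_zero (nf ω) (ng ω),
    fun ω => θ ω + φ ω, cθ.add cφ, fun ω => ?_, by push_cast; linarith⟩
  have h1 := hθ ω
  have h2 := hφ ω
  simp only [sub_zero] at h1 h2 ⊢
  rw [norm_mul]
  push_cast
  rw [mul_add, Complex.exp_add]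
  conv_lhs => rw [h1, h2]
  ring

theorem inv {f : EReal → ℂ} {v : ℤ} (hf : IsWindingNumber f 0 v) :
    IsWindingNumber (fun ω => (f ω)⁻¹) 0 (-v) := by
  obtain ⟨cf, ef, nf, θ, cθ, hθ, dθ⟩ := hf
  refine ⟨cf.inv₀ nf, by simp only [ef], fun ω => inv_ne_zero (nf ω),
    fun ω => -θ ω, cθ.neg, fun ω => ?_, by push_cast; linarith⟩
  have h1 := hθ ω
  simp only [sub_zero] at h1 ⊢
  rw [norm_inv]
  push_cast
  rw [mul_neg, Complex.exp_neg]
  conv_lhs => rw [h1]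
  rw [mul_inv]

/-- The principal argument is continuous on the slit plane, and it takes equal values at the two
ends of a closed curve. -/
theorem of_slitPlane {f : EReal → ℂ} (hf : Continuous f) (he : f ⊥ = f ⊤)
    (h : ∀ ω, f ω ∈ Complex.slitPlane) : IsWindingNumber f 0 0 := by
  refine ⟨hf, he, fun ω => Complex.slitPlane_ne_zero (h ω), fun ω => (f ω).arg,
    continuous_iff_continuousAt.2 fun ω => (Complex.continuousAt_arg (h ω)).comp hf.continuousAt,
    fun ω => ?_, by simp [he]⟩
  rw [sub_zero, mul_comm Complex.I, Complex.norm_mul_exp_arg_mul_I]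

theorem const {c : ℂ} (hc : c ≠ 0) : IsWindingNumber (fun _ => c) 0 0 := by
  refine ⟨continuous_const, rfl, fun _ => hc, fun _ => c.arg, continuous_const, fun ω => ?_,
    by simp⟩
  rw [sub_zero, mul_comm Complex.I, Complex.norm_mul_exp_arg_mul_I]

theorem multiset_prod {ι : Type*} (s : Multiset ι) (f : ι → EReal → ℂ) (v : ι → ℤ)
    (h : ∀ i ∈ s, IsWindingNumber (f i) 0 (v i)) :
    IsWindingNumber (fun ω => (s.map fun i => f i ω).prod) 0 (s.map v).sum := by
  induction s using Multiset.induction with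
  | empty => simpa using const one_ne_zero
  | cons a s ih =>
    simp only [Multiset.map_cons, Multiset.prod_cons, Multiset.sum_cons]
    exact (h a (Multiset.mem_cons_self a s)).mul
      (ih fun i hi => h i (Multiset.mem_cons_of_mem hi))

/-- Two continuous arguments differ by `2π` times an integer-valued continuous function, which is
constant because the extended real line is connected. -/
theorem unique {γ : EReal → ℂ} {s : ℂ} {v w : ℤ} (hv : IsWindingNumber γ s v)
    (hw : IsWindingNumber γ s w) : v = w := by
  obtain ⟨-, -, nf, θ, cθ, hθ, dθ⟩ := hv
  obtain ⟨-, -, -, φ, cφ, hφ, dφ⟩ := hw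
  have hpi : (2 * Real.pi) ≠ 0 := by positivity
  have key : ∀ ω, ∃ n : ℤ, (θ ω - φ ω) / (2 * Real.pi) = n := fun ω => by
    have h := (hθ ω).symm.trans (hφ ω)
    have h0 : ((‖γ ω - s‖ : ℝ) : ℂ) ≠ 0 := by
      simpa [sub_eq_zero] using nf ω
    obtain ⟨n, hn⟩ := Complex.exp_eq_exp_iff_exists_int.1 (mul_left_cancel₀ h0 h)
    refine ⟨n, ?_⟩
    have h2 : (θ ω : ℂ) = φ ω + n * (2 * Real.pi) := by
      refine mul_left_cancel₀ Complex.I_ne_zero ?_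
      rw [hn]; ring
    have h3 : θ ω = φ ω + n * (2 * Real.pi) := by exact_mod_cast h2
    rw [h3]; field_simp; ring
  choose N hN using key
  have hc : Continuous N := by
    rw [Int.isClosedEmbedding_coe_real.isEmbedding.continuous_iff]
    have : ((fun n : ℤ => (n : ℝ)) ∘ N) = fun ω => (θ ω - φ ω) / (2 * Real.pi) :=
      funext fun ω => (hN ω).symm
    rw [this]
    exact (cθ.sub cφ).div_const _
  have hcon : N ⊤ = N ⊥ := PreconnectedSpace.constant inferInstance hc
  have h1 := hN ⊤
  have h2 := hN ⊥
  rw [div_eq_iff hpi] at h1 h2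
  rw [hcon] at h1
  have : (2 * Real.pi) * (v - w : ℝ) = 0 := by linarith
  have h3 : (v : ℝ) = w := by
    rcases mul_eq_zero.1 this with h | h
    · exact absurd h hpi
    · linarith
  exact_mod_cast h3

end IsWindingNumber

/-! ### Linear factors along a curve which agrees with the imaginary axis near infinity -/

/-- The quotient `(z - a) / (z + 1)` along the curve `z`, extended by `1` at `±∞`. -/
def axisFactor (z : ℝ → ℂ) (a : ℂ) (ω : EReal) : ℂ :=
  if ω = ⊥ ∨ ω = ⊤ then 1 else (z ω.toReal - a) / (z ω.toReal + 1)

@[simp] theorem axisFactor_bot (z : ℝ → ℂ) (a : ℂ) : axisFactor z a ⊥ = 1 := by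
  simp [axisFactor]

@[simp] theorem axisFactor_top (z : ℝ → ℂ) (a : ℂ) : axisFactor z a ⊤ = 1 := by
  simp [axisFactor]

@[simp] theorem axisFactor_coe (z : ℝ → ℂ) (a : ℂ) (ω : ℝ) :
    axisFactor z a ω = (z ω - a) / (z ω + 1) := by
  simp [axisFactor]

theorem add_one_ne_zero_of_re_nonneg {z : ℂ} (hz : 0 ≤ z.re) : z + 1 ≠ 0 := fun h => by
  have := congrArg Complex.re h
  simp at this
  linarith

/-- The factor equals `1 - (1 + a)/(z + 1)`, so it tends to `1` at both ends. The normalizing root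
`-1` lies to the left of the curve, so it creates neither zeros nor winding. -/
theorem continuous_axisFactor {z : ℝ → ℂ} (hz : Continuous z) (hre : ∀ ω, 0 ≤ (z ω).re)
    (hinf : ∀ᶠ ω in cocompact ℝ, z ω = Complex.I * ω) (a : ℂ) :
    Continuous (axisFactor z a) := by
  have hlim : Tendsto (fun ω : ℝ => axisFactor z a ω) (cocompact ℝ) (𝓝 1) := by
    have h1 : Tendsto (fun ω : ℝ => 1 - (1 + a) * (Complex.I * ω + 1)⁻¹) (cocompact ℝ)
        (𝓝 (1 - (1 + a) * 0)) := by
      refine tendsto_const_nhds.sub (tendsto_const_nhds.mul ?_)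
      refine tendsto_inv₀_cobounded.comp ?_
      rw [← tendsto_norm_atTop_iff_cobounded]
      refine tendsto_atTop_mono (fun ω => ?_) (tendsto_norm_cocompact_atTop (E := ℝ))
      have := Complex.abs_im_le_norm (Complex.I * ω + 1)
      simpa using this
    rw [mul_zero, sub_zero] at h1
    refine h1.congr' ?_
    filter_upwards [hinf] with ω hω
    have h0 := add_one_ne_zero_of_re_nonneg (hre ω)
    rw [axisFactor_coe, ← hω]
    field_simp
    ring
  rw [cocompact_eq_atBot_atTop, tendsto_sup] at hlim
  refine EReal.continuous_of_tendsto ?_ (by simpa using hlim.2) (by simpa using hlim.1)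
  simp only [axisFactor_coe]
  exact (hz.sub continuous_const).div (hz.add continuous_const) fun ω =>
    add_one_ne_zero_of_re_nonneg (hre ω)

/-- The factor is never a real `t ≤ 0`. From `z - a = t (z + 1)` with `t < 0`, the real part is
nonnegative on the left and negative on the right; `t = 0` means `z = a`. -/
theorem isWindingNumber_axisFactor_left {z : ℝ → ℂ} (hz : Continuous z)
    (hre : ∀ ω, 0 ≤ (z ω).re) (hinf : ∀ᶠ ω in cocompact ℝ, z ω = Complex.I * ω) {a : ℂ}
    (ha : a.re ≤ 0) (haz : ∀ ω, z ω ≠ a) : IsWindingNumber (axisFactor z a) 0 0 := by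
  refine IsWindingNumber.of_slitPlane (continuous_axisFactor hz hre hinf a) (by simp) fun ω => ?_
  induction ω with
  | bot => simp
  | top => simp
  | coe ω =>
    rw [axisFactor_coe, Complex.mem_slitPlane_iff_not_le_zero]
    intro h
    have h0 := add_one_ne_zero_of_re_nonneg (hre ω)
    obtain ⟨t, ht⟩ : ∃ t : ℝ, (z ω - a) / (z ω + 1) = t :=
      ⟨((z ω - a) / (z ω + 1)).re, Complex.ext rfl (by simpa using (Complex.le_def.1 h).2)⟩
    have ht0 : t ≤ 0 := by
      rw [ht] at h
      exact_mod_cast h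
    rw [div_eq_iff h0] at ht
    have hr := congrArg Complex.re ht
    simp at hr
    have h1 := hre ω
    rcases ht0.lt_or_eq with h2 | h2
    · nlinarith
    · rw [h2] at ht
      exact haz ω (sub_eq_zero.1 (by simpa using ht))

/-- Comparing real parts as in the left case shows that the factor is never a real `t ≥ 0` at finite
`ω`. Its negative thus stays in the slit plane there and meets the cut only at `±∞`, where it is
`-1`: the argument falls from `π` to `-π`. -/
theorem isWindingNumber_axisFactor_right {z : ℝ → ℂ} (hz : Continuous z)
    (hre : ∀ ω, 0 ≤ (z ω).re) (hinf : ∀ᶠ ω in cocompact ℝ, z ω = Complex.I * ω) {a : ℂ}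
    (haz : ∀ ω, (z ω).re < a.re) : IsWindingNumber (axisFactor z a) 0 (-1) := by
  have hcont := continuous_axisFactor hz hre hinf a
  have hneg : Continuous fun ω => -axisFactor z a ω := hcont.neg
  have ha : 0 < a.re := (hre 0).trans_lt (haz 0)
  have hslit : ∀ ω : ℝ, -axisFactor z a ω ∈ Complex.slitPlane := fun ω => by
    rw [axisFactor_coe, Complex.mem_slitPlane_iff_not_le_zero]
    intro h
    have h0 := add_one_ne_zero_of_re_nonneg (hre ω)
    obtain ⟨t, ht⟩ : ∃ t : ℝ, (z ω - a) / (z ω + 1) = t :=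
      ⟨((z ω - a) / (z ω + 1)).re, Complex.ext rfl (by simpa using (Complex.le_def.1 h).2)⟩
    have ht0 : 0 ≤ t := by
      rw [ht] at h
      have h' : -t ≤ 0 := by exact_mod_cast h
      linarith
    rw [div_eq_iff h0] at ht
    have hr := congrArg Complex.re ht
    simp at hr
    have h1 := hre ω
    have h2 := haz ω
    nlinarith
  -- On the axis the sign of this imaginary part, opposite to that of `ω` for large `|ω|`, decides
  -- from which side the cut is approached.
  have him : ∀ ω : ℝ, z ω = Complex.I * ω →
      (-axisFactor z a ω).im = (a.im - (1 + a.re) * ω) / Complex.normSq (z ω + 1) := by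
    intro ω hω
    rw [axisFactor_coe, hω, Complex.neg_im, Complex.div_im]
    simp
    ring
  have hpos : ∀ ω : ℝ, 0 < Complex.normSq (z ω + 1) := fun ω =>
    Complex.normSq_pos.2 (add_one_ne_zero_of_re_nonneg (hre ω))
  have hinf' := hinf
  rw [cocompact_eq_atBot_atTop, eventually_sup] at hinf'
  have htop : Tendsto (fun ω : ℝ => (-axisFactor z a ω).arg) atTop (𝓝 (-Real.pi)) := by
    refine (Complex.tendsto_arg_nhdsWithin_im_neg_of_re_neg_of_im_zero (z := -1)
      (by simp) (by simp)).comp (tendsto_nhdsWithin_iff.2 ⟨?_, ?_⟩)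
    · have := (hneg.tendsto ⊤).comp EReal.tendsto_coe_atTop
      simpa only [axisFactor_bot, axisFactor_top, Function.comp_def] using this
    · filter_upwards [hinf'.2, eventually_gt_atTop (a.im / (1 + a.re))] with ω hω h
      rw [div_lt_iff₀ (by linarith)] at h
      refine (him ω hω).trans_lt (div_neg_of_neg_of_pos (by linarith) (hpos ω))
  have hbot : Tendsto (fun ω : ℝ => (-axisFactor z a ω).arg) atBot (𝓝 Real.pi) := by
    refine (Complex.tendsto_arg_nhdsWithin_im_nonneg_of_re_neg_of_im_zero (z := -1)
      (by simp) (by simp)).comp (tendsto_nhdsWithin_iff.2 ⟨?_, ?_⟩)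
    · have := (hneg.tendsto ⊥).comp EReal.tendsto_coe_atBot
      simpa only [axisFactor_bot, axisFactor_top, Function.comp_def] using this
    · filter_upwards [hinf'.1, eventually_lt_atBot (a.im / (1 + a.re))] with ω hω h
      rw [lt_div_iff₀ (by linarith)] at h
      have : 0 ≤ (-axisFactor z a ω).im := by
        rw [him ω hω]
        exact div_nonneg (by linarith) (hpos ω).le
      exact this
  have hwind : IsWindingNumber (fun ω => -axisFactor z a ω) 0 (-1) := by
    -- Only the value at `⊤` needs correcting: `arg (-1) = π` is already the right limit at `⊥`.
    refine ⟨hneg, by simp, fun ω => ?_, fun ω => if ω = ⊤ then -Real.pi else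
      (-axisFactor z a ω).arg, ?_, fun ω => ?_, ?_⟩
    · induction ω with
      | bot => simp
      | top => simp
      | coe ω => exact Complex.slitPlane_ne_zero (hslit ω)
    · refine EReal.continuous_of_tendsto ?_ (by simpa using htop) (by simpa using hbot)
      simp only [EReal.coe_ne_top, if_false]
      exact continuous_iff_continuousAt.2 fun ω => ContinuousAt.comp (f := fun x : ℝ => -axisFactor z a x)
        (Complex.continuousAt_arg (hslit ω)) (hneg.comp continuous_coe_real_ereal).continuousAt
    · rw [sub_zero]
      beta_reduce
      split_ifs with h
      · subst h
        push_cast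
        rw [mul_neg, Complex.exp_neg, mul_comm Complex.I, Complex.exp_pi_mul_I]
        simp
      · rw [mul_comm Complex.I, Complex.norm_mul_exp_arg_mul_I]
    · simp
      ring
  have h := hwind.mul (IsWindingNumber.const (c := -1) (by simp))
  simpa using h

/-! ### The transfer function as a quotient of polynomials -/

open Polynomial in
-- `B * R` has rank at most one, so the determinant is affine in `s`; the values at `s = 0` and `s =
-- 1` determine it. Multiplying by `M.charpoly` covers the points where the resolvent does not
-- exist.
theorem Matrix.charpoly_sub_smul_mul {F : Type*} [Field F] [Infinite F] {n : ℕ}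
    (M : Matrix (Fin n) (Fin n) F) (B : Matrix (Fin n) (Fin 1) F) (R : Matrix (Fin 1) (Fin n) F)
    (s : F) : (M - s • (B * R)).charpoly =
      M.charpoly + C s * ((M - B * R).charpoly - M.charpoly) := by
  have key : ∀ t z : F, M.charpoly.eval z ≠ 0 → (M - t • (B * R)).charpoly.eval z =
      M.charpoly.eval z * (1 + t * (R * (Matrix.scalar (Fin n) z - M)⁻¹ * B) 0 0) := by
    intro t z hz
    rw [Matrix.eval_charpoly] at hz ⊢
    rw [Matrix.eval_charpoly, sub_sub_eq_add_sub, add_sub_right_comm, ← Matrix.smul_mul,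
      Matrix.det_add_mul _ _ (isUnit_iff_ne_zero.2 hz), Matrix.det_fin_one]
    simp
  have hmul : M.charpoly * (M - s • (B * R)).charpoly =
      M.charpoly * (M.charpoly + C s * ((M - B * R).charpoly - M.charpoly)) := by
    refine Polynomial.funext fun z => ?_
    by_cases hz : M.charpoly.eval z = 0
    · simp [hz]
    · have h1 := key 1 z hz
      rw [one_smul] at h1
      simp only [eval_mul, eval_add, eval_sub, eval_C, key s z hz, h1]
      ring
  exact mul_left_cancel₀ M.charpoly_monic.ne_zero hmul

namespace LTISystem

/-- The denominator of the transfer function: the characteristic polynomial of `A`. -/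
def denominator {n : ℕ} (P : LTISystem n 1 1) : Polynomial ℝ := P.A.charpoly

/-- The numerator of the transfer function with respect to `denominator`. -/
def numerator {n : ℕ} (P : LTISystem n 1 1) : Polynomial ℝ :=
  (P.A - P.B * P.C).charpoly - P.A.charpoly

theorem denominator_monic {n : ℕ} (P : LTISystem n 1 1) : P.denominator.Monic :=
  P.A.charpoly_monic

theorem natDegree_denominator {n : ℕ} (P : LTISystem n 1 1) : P.denominator.natDegree = n := by
  simp [denominator]

theorem degree_numerator_lt {n : ℕ} (P : LTISystem n 1 1) :
    P.numerator.degree < P.denominator.degree := by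
  have h : (P.A - P.B * P.C).charpoly.degree = P.A.charpoly.degree := by
    simp [Matrix.charpoly_degree_eq_dim]
  have := Polynomial.degree_sub_lt_left h (Matrix.charpoly_monic _).ne_zero
    (by rw [(Matrix.charpoly_monic _).leadingCoeff, (Matrix.charpoly_monic _).leadingCoeff])
  rwa [h] at this

theorem map_denominator {n : ℕ} (P : LTISystem n 1 1) :
    P.denominator.map Complex.ofRealHom = (P.A.map Complex.ofReal).charpoly :=
  (Matrix.charpoly_map P.A Complex.ofRealHom).symm

theorem charpoly_closedLoop {n : ℕ} (P : LTISystem n 1 1) (s : ℂ) :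
    (P.A.map Complex.ofReal - s • (P.B.map Complex.ofReal * P.C.map Complex.ofReal)).charpoly =
      P.denominator.map Complex.ofRealHom +
        Polynomial.C s * P.numerator.map Complex.ofRealHom := by
  rw [Matrix.charpoly_sub_smul_mul, map_denominator, numerator, Polynomial.map_sub,
    ← Matrix.charpoly_map, ← Matrix.charpoly_map]
  congr 4
  ext i j
  simp [Matrix.mul_apply]

theorem mem_spectrum_iff_eval_denominator {n : ℕ} (P : LTISystem n 1 1) (z : ℂ) :
    z ∈ spectrum ℂ (P.A.map Complex.ofReal) ↔
      (P.denominator.map Complex.ofRealHom).eval z = 0 := by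
  rw [Matrix.mem_spectrum_iff_isRoot_charpoly, map_denominator, Polynomial.IsRoot]

theorem transferFunction_eq {n : ℕ} (P : LTISystem n 1 1) (z : ℂ) :
    P.transferFunction z = (P.numerator.map Complex.ofRealHom).eval z /
      (P.denominator.map Complex.ofRealHom).eval z := by
  have hM : z • (1 : Matrix (Fin n) (Fin n) ℂ) - P.A.map Complex.ofReal =
      Matrix.scalar (Fin n) z - P.A.map Complex.ofReal := by
    rw [Matrix.scalar_apply, Matrix.smul_one_eq_diagonal]
  have hd : (P.denominator.map Complex.ofRealHom).eval z =
      (Matrix.scalar (Fin n) z - P.A.map Complex.ofReal).det := by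
    rw [map_denominator, Matrix.eval_charpoly]
  by_cases hz : (P.denominator.map Complex.ofRealHom).eval z = 0
  -- At an eigenvalue both sides are `0` by convention: a singular matrix has inverse `0`, and so
  -- does the number `0`.
  · rw [hz, div_zero, transferFunction, hM, Matrix.nonsing_inv_apply_not_isUnit]
    · simp
    · rw [← hd, hz]; simp
  · rw [eq_div_iff hz]
    have h := congrArg (Polynomial.eval z) (P.charpoly_closedLoop 1)
    rw [one_smul, Matrix.eval_charpoly, sub_sub_eq_add_sub, add_sub_right_comm,
      Matrix.det_add_mul _ _ (isUnit_iff_ne_zero.2 (hd ▸ hz)), Matrix.det_fin_one, ← hd,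
      Polynomial.eval_add, Polynomial.C_1, one_mul, Matrix.add_apply, Matrix.one_apply_eq,
      ← hM] at h
    rw [transferFunction]
    linear_combination h

/-- The controllable canonical form realizes every strictly proper rational function. -/
theorem exists_realization {p q : Polynomial ℝ} (hp : p.Monic) (hq : q.degree < p.degree) :
    ∃ P : LTISystem p.natDegree 1 1, ∀ s : ℂ, s ∉ spectrum ℂ (P.A.map Complex.ofReal) →
      (p.map Complex.ofRealHom).eval s ≠ 0 →
      P.transferFunction s =
        (q.map Complex.ofRealHom).eval s / (p.map Complex.ofRealHom).eval s := by
  set m := p.natDegree with hm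
  refine ⟨⟨Matrix.of fun i j => (if (i : ℕ) + 1 = j then 1 else 0) -
    if (i : ℕ) + 1 = m then p.coeff j else 0,
    Matrix.of fun i _ => if (i : ℕ) + 1 = m then 1 else 0, Matrix.of fun _ j => q.coeff j⟩,
    fun s hs hps => ?_⟩
  rw [spectrum.notMem_iff, Algebra.algebraMap_eq_smul_one] at hs
  rw [eq_div_iff hps]
  unfold transferFunction
  dsimp only at hs ⊢
  set M := s • (1 : Matrix (Fin m) (Fin m) ℂ) - Matrix.map (Matrix.of fun i j : Fin m =>
    (if (i : ℕ) + 1 = j then (1 : ℝ) else 0) - if (i : ℕ) + 1 = m then p.coeff j else 0)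
    Complex.ofReal with hMdef
  -- The vector `(1, s, …, s ^ (m - 1))` solves `(s - A) v = p(s) b`, and pairing it with the
  -- coefficients of `q` gives `q(s)`.
  set v : Matrix (Fin m) (Fin 1) ℂ := Matrix.of fun i _ => s ^ (i : ℕ) with hv
  set b : Matrix (Fin m) (Fin 1) ℂ := Matrix.map (Matrix.of fun (i : Fin m) (_ : Fin 1) =>
    if (i : ℕ) + 1 = m then (1 : ℝ) else 0) Complex.ofReal with hb
  have hMv : M * v = (p.map Complex.ofRealHom).eval s • b := by
    have hps' : (p.map Complex.ofRealHom).eval s =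
        (∑ k : Fin m, (p.coeff k : ℂ) * s ^ (k : ℕ)) + s ^ m := by
      rw [Polynomial.eval_map, Polynomial.eval₂_eq_sum_range, Finset.sum_range_succ,
        Fin.sum_univ_eq_sum_range (fun k => (p.coeff k : ℂ) * s ^ k), ← hm, hm,
        hp.coeff_natDegree]
      simp
    ext i j
    rw [hMdef, Matrix.sub_mul, Matrix.smul_mul, Matrix.one_mul, hps']
    simp only [hv, hb, Matrix.sub_apply, Matrix.smul_apply, Matrix.mul_apply, Matrix.map_apply,
      Matrix.of_apply, smul_eq_mul]
    by_cases hi : (i : ℕ) + 1 = m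
    · simp only [hi, if_true]
      have h1 : ∀ k : Fin m, m ≠ k := fun k => by omega
      simp only [h1, if_false, zero_sub, Complex.ofReal_neg, neg_mul, Finset.sum_neg_distrib]
      rw [← pow_succ', hi]
      simp
      ring
    · have h0 : (i : ℕ) + 1 < m := by omega
      simp only [hi, if_false, sub_zero]
      rw [Finset.sum_eq_single (⟨i + 1, h0⟩ : Fin m)]
      · simp [pow_succ']
      · intro k _ hk
        rw [if_neg fun h => hk (Fin.ext h.symm)]
        simp
      · simp
  have hb' : (p.map Complex.ofRealHom).eval s • (M⁻¹ * b) = v := by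
    rw [← Matrix.mul_smul, ← hMv, Matrix.nonsing_inv_mul_cancel_left]
    exact (Matrix.isUnit_iff_isUnit_det _).1 hs
  rw [Matrix.mul_assoc, mul_comm, ← smul_eq_mul, ← Matrix.smul_apply, ← Matrix.mul_smul, hb']
  -- For `m = 0` the zero polynomial has `natDegree` `0`, not less than `m`, hence the separate
  -- case.
  have hqm : q.natDegree < m ∨ q = 0 := by
    by_cases h : q = 0
    · exact Or.inr h
    · exact Or.inl (Polynomial.natDegree_lt_natDegree h hq)
  rcases hqm with hqm | rfl
  · rw [Polynomial.eval_map, Polynomial.eval₂_eq_sum_range' _ hqm,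
      ← Fin.sum_univ_eq_sum_range (fun k => Complex.ofRealHom (q.coeff k) * s ^ k)]
    simp [Matrix.mul_apply, hv]
  · simp [Matrix.mul_apply]

/-- A common factor `g` could be cancelled, and the reduced fraction would be realized with `n - deg
g` states. -/
theorem IsMinimal.isCoprime {n : ℕ} {P : LTISystem n 1 1} (hP : P.IsMinimal) :
    IsCoprime P.numerator P.denominator := by
  by_contra h
  rw [← EuclideanDomain.gcd_isUnit_iff] at h
  obtain ⟨g, hg, hgi, hgd⟩ := Polynomial.exists_monic_irreducible_factor _ h
  obtain ⟨q, hq⟩ := hgd.trans (EuclideanDomain.gcd_dvd_left _ _)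
  obtain ⟨p, hp⟩ := hgd.trans (EuclideanDomain.gcd_dvd_right _ _)
  have hpm : p.Monic := hg.of_mul_monic_left (hp ▸ P.denominator_monic)
  have hdeg : q.degree < p.degree := by
    have := P.degree_numerator_lt
    rw [hq, hp, Polynomial.degree_mul, Polynomial.degree_mul] at this
    exact lt_of_add_lt_add_left this
  obtain ⟨P', hP'⟩ := exists_realization hpm hdeg
  have hle := hP _ P' fun s hs hs' => by
    rw [mem_spectrum_iff_eval_denominator, hp, Polynomial.map_mul, Polynomial.eval_mul,
      mul_eq_zero, not_or] at hs
    rw [hP' s hs' hs.2, transferFunction_eq, hq, hp, Polynomial.map_mul, Polynomial.map_mul,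
      Polynomial.eval_mul, Polynomial.eval_mul, mul_div_mul_left _ _ hs.1]
  have h1 := hgi.natDegree_pos
  have h2 := P.natDegree_denominator
  rw [hp, hg.natDegree_mul hpm] at h2
  omega

end LTISystem

/-! ### Poles of rational functions -/

open Polynomial in
theorem meromorphicOrderAt_polynomial_eval {p : ℂ[X]} (hp : p ≠ 0) (a : ℂ) :
    meromorphicOrderAt (fun z => p.eval z) a = (p.rootMultiplicity a : ℤ) := by
  obtain ⟨g, hg, hga⟩ := exists_eq_pow_rootMultiplicity_mul_and_not_dvd p hp a
  have han : ∀ r : ℂ[X], AnalyticAt ℂ (fun z => r.eval z) a := fun r =>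
    (AnalyticOnNhd.eval_polynomial r) a (Set.mem_univ a)
  rw [meromorphicOrderAt_eq_int_iff (han p).meromorphicAt]
  refine ⟨fun z => g.eval z, han g, fun h => hga (dvd_iff_isRoot.2 h), .of_forall fun z => ?_⟩
  conv_lhs => rw [hg]
  simp

open Polynomial in
-- Coprimality forbids cancellation: `q` does not vanish at a root of `p`.
theorem poleOrder_eval_div_eval {p q : ℂ[X]} (hp : p ≠ 0) (h : IsCoprime q p) (a : ℂ) :
    poleOrder (fun z => q.eval z / p.eval z) a = p.rootMultiplicity a ∧
      (IsPole (fun z => q.eval z / p.eval z) a ↔ p.eval a = 0) := by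
  have hq : ∀ r : ℂ[X], AnalyticAt ℂ (fun z => r.eval z) a := fun r =>
    (AnalyticOnNhd.eval_polynomial r) a (Set.mem_univ a)
  unfold poleOrder IsPole
  by_cases ha : p.eval a = 0
  · have hqa : q.eval a ≠ 0 := fun h0 => by
      obtain ⟨u, v, huv⟩ := h
      simpa [h0, ha] using congrArg (eval a) huv
    have hq0 : q ≠ 0 := fun h0 => hqa (by simp [h0])
    have hm : 0 < p.rootMultiplicity a := (rootMultiplicity_pos hp).2 ha
    have key : meromorphicOrderAt (fun z => q.eval z / p.eval z) a =
        ((-(p.rootMultiplicity a : ℤ) : ℤ) : WithTop ℤ) := by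
      rw [fun_meromorphicOrderAt_div (hq q).meromorphicAt (hq p).meromorphicAt,
        meromorphicOrderAt_polynomial_eval hp, meromorphicOrderAt_polynomial_eval hq0,
        rootMultiplicity_eq_zero hqa]
      exact congrArg WithTop.some (by simp : ((0 : ℕ) : ℤ) - (p.rootMultiplicity a : ℤ) = _)
    rw [key]
    refine ⟨by simp, iff_of_true ?_ ha⟩
    exact_mod_cast (by omega : -(p.rootMultiplicity a : ℤ) < 0)
  · have hnn : 0 ≤ meromorphicOrderAt (fun z => q.eval z / p.eval z) a :=
      ((hq q).fun_div (hq p) ha).meromorphicOrderAt_nonneg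
    refine ⟨?_, iff_of_false hnn.not_gt ha⟩
    rw [rootMultiplicity_eq_zero ha, Int.toNat_eq_zero, Left.neg_nonpos_iff]
    -- The order is `⊤` when `q = 0`; `untop₀` then returns `0`.
    generalize meromorphicOrderAt (fun z => q.eval z / p.eval z) a = o at hnn
    induction o with
    | top => simp
    | coe o => exact_mod_cast hnn

/-- The number of points of a multiset of complex numbers in the open right half plane. -/
def rhpCount (s : Multiset ℂ) : ℕ := (s.filter fun a => 0 < a.re).card

theorem sum_map_neg_ite_eq_neg_rhpCount (s : Multiset ℂ) :
    (s.map fun a => if 0 < a.re then (-1 : ℤ) else 0).sum = -(rhpCount s : ℤ) := by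
  unfold rhpCount
  induction s using Multiset.induction with
  | empty => simp
  | cons a s ih =>
    rw [Multiset.map_cons, Multiset.sum_cons, ih]
    by_cases h : 0 < a.re
    · rw [Multiset.filter_cons_of_pos (p := fun a : ℂ => 0 < a.re) _ h, if_pos h, Multiset.card_cons]
      push_cast
      ring
    · rw [Multiset.filter_cons_of_neg (p := fun a : ℂ => 0 < a.re) _ h, if_neg h, zero_add]

namespace LTISystem

/-- The complex transfer polynomials are coprime for a minimal system. -/
theorem IsMinimal.isCoprime_map {n : ℕ} {P : LTISystem n 1 1} (hP : P.IsMinimal) :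
    IsCoprime (P.numerator.map Complex.ofRealHom) (P.denominator.map Complex.ofRealHom) :=
  hP.isCoprime.map (Polynomial.mapRingHom Complex.ofRealHom)

theorem map_denominator_monic {n : ℕ} (P : LTISystem n 1 1) :
    (P.denominator.map Complex.ofRealHom).Monic := P.denominator_monic.map _

theorem transferFunction_eq_fun {n : ℕ} (P : LTISystem n 1 1) : P.transferFunction =
    fun z => (P.numerator.map Complex.ofRealHom).eval z /
      (P.denominator.map Complex.ofRealHom).eval z :=
  funext P.transferFunction_eq

theorem IsMinimal.isPole_iff {n : ℕ} {P : LTISystem n 1 1} (hP : P.IsMinimal) (z : ℂ) :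
    IsPole P.transferFunction z ↔ (P.denominator.map Complex.ofRealHom).eval z = 0 := by
  rw [transferFunction_eq_fun]
  exact (poleOrder_eval_div_eval P.map_denominator_monic.ne_zero hP.isCoprime_map z).2

theorem IsMinimal.numUnstablePoles_eq {n : ℕ} {P : LTISystem n 1 1} (hP : P.IsMinimal) :
    P.numUnstablePoles = rhpCount (P.denominator.map Complex.ofRealHom).roots := by
  classical
  have h : ∀ z, poleOrder P.transferFunction z =
      (P.denominator.map Complex.ofRealHom).roots.count z := fun z => by
    rw [transferFunction_eq_fun, Polynomial.count_roots]
    exact (poleOrder_eval_div_eval P.map_denominator_monic.ne_zero hP.isCoprime_map z).1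
  unfold numUnstablePoles rhpCount
  set s := (P.denominator.map Complex.ofRealHom).roots
  have hs : Set.indicator {z : ℂ | 0 < z.re} (poleOrder P.transferFunction) =
      fun z => (s.filter fun a => 0 < a.re).count z := by
    funext z
    rw [Multiset.count_filter, Set.indicator_apply, h]
    rfl
  rw [finsum_mem_def, hs, finsum_eq_sum_of_support_subset
    (s := (s.filter fun a => 0 < a.re).toFinset), Multiset.toFinset_sum_count_eq]
  intro z hz
  rw [Function.mem_support, Multiset.count_ne_zero] at hz
  simpa using hz

/-! ### The indented imaginary axis -/

/-- The frequencies of the poles of the transfer function on the imaginary axis. -/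
def poleFrequencies {n : ℕ} (P : LTISystem n 1 1) : Set ℝ :=
  {ω | IsPole P.transferFunction (Complex.I * ω)}

theorem IsMinimal.finite_poleFrequencies {n : ℕ} {P : LTISystem n 1 1} (hP : P.IsMinimal) :
    P.poleFrequencies.Finite := by
  have h := (P.denominator.map Complex.ofRealHom).roots.toFinset.finite_toSet
  refine (h.preimage (f := fun ω : ℝ => Complex.I * ω) ?_).subset fun ω hω => ?_
  · intro x _ y _ hxy
    simpa using hxy
  · have := (hP.isPole_iff _).1 hω
    simpa [Polynomial.mem_roots P.map_denominator_monic.ne_zero] using this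

theorem indentedAxis_cases {n : ℕ} (P : LTISystem n 1 1) {ε : ℝ} (hε : 0 < ε) (ω : ℝ) :
    (P.indentedAxis ε ω = Complex.I * ω ∧ ∀ ω₀ ∈ P.poleFrequencies, ε ≤ |ω - ω₀|) ∨
      (0 < (P.indentedAxis ε ω).re ∧ (P.indentedAxis ε ω).re ≤ ε) := by
  unfold indentedAxis
  split_ifs with h
  · right
    have h2 := h.choose_spec.2
    set ω₀ := h.choose
    have harg : Complex.I * Real.pi / (2 * ε) * (ω - ω₀) =
        ((Real.pi * (ω - ω₀) / (2 * ε) : ℝ) : ℂ) * Complex.I := by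
      push_cast; ring
    have hre : (Complex.I * ω₀ + ε * Complex.exp (Complex.I * Real.pi / (2 * ε) * (ω - ω₀))).re =
        ε * Real.cos (Real.pi * (ω - ω₀) / (2 * ε)) := by
      rw [harg, Complex.add_re, Complex.re_ofReal_mul, Complex.exp_ofReal_mul_I_re]
      simp
    rw [hre]
    obtain ⟨h3, h4⟩ := abs_lt.1 h2
    refine ⟨mul_pos hε (Real.cos_pos_of_mem_Ioo ⟨?_, ?_⟩),
      mul_le_of_le_one_right hε.le (Real.cos_le_one _)⟩
    · rw [lt_div_iff₀ (by positivity)]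
      nlinarith [Real.pi_pos]
    · rw [div_lt_iff₀ (by positivity)]
      nlinarith [Real.pi_pos]
  · push Not at h
    exact Or.inl ⟨rfl, fun ω₀ h0 => h ω₀ h0⟩

theorem indentedAxis_of_forall_le {n : ℕ} (P : LTISystem n 1 1) {ε ω : ℝ}
    (h : ∀ ω₀ ∈ P.poleFrequencies, ε ≤ |ω - ω₀|) : P.indentedAxis ε ω = Complex.I * ω := by
  rw [indentedAxis, dif_neg]
  rintro ⟨ω₀, h1, h2⟩
  exact (h ω₀ h1).not_gt h2

theorem indentedAxis_re_nonneg {n : ℕ} (P : LTISystem n 1 1) {ε : ℝ} (hε : 0 < ε) (ω : ℝ) :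
    0 ≤ (P.indentedAxis ε ω).re := by
  rcases P.indentedAxis_cases hε ω with h | h
  · simp [h.1]
  · exact h.1.le

theorem indentedAxis_re_le {n : ℕ} (P : LTISystem n 1 1) {ε : ℝ} (hε : 0 < ε) (ω : ℝ) :
    (P.indentedAxis ε ω).re ≤ ε := by
  rcases P.indentedAxis_cases hε ω with h | h
  · simpa [h.1] using hε.le
  · exact h.2

theorem eventually_indentedAxis_eq {n : ℕ} {P : LTISystem n 1 1}
    (hW : P.poleFrequencies.Finite) (ε : ℝ) :
    ∀ᶠ ω in cocompact ℝ, P.indentedAxis ε ω = Complex.I * ω := by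
  have h : ∀ᶠ ω in cocompact ℝ, ∀ ω₀ ∈ P.poleFrequencies, ε ≤ |ω - ω₀| := by
    rw [hW.eventually_all]
    intro ω₀ _
    exact (tendsto_dist_right_cocompact_atTop ω₀).eventually_ge_atTop ε
  exact h.mono fun ω hω => P.indentedAxis_of_forall_le hω

/-- The deviation of the half circle of radius `ε` from the imaginary axis. -/
def indentation (ε t : ℝ) : ℂ :=
  ε * Complex.exp (Complex.I * Real.pi / (2 * ε) * (max (-ε) (min t ε) : ℝ)) -
    Complex.I * (max (-ε) (min t ε) : ℝ)

theorem continuous_indentation (ε : ℝ) : Continuous (indentation ε) := by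
  unfold indentation
  fun_prop

/-- The clamped half circle ends at `±iε`, where it rejoins the axis, so the deviation extends
continuously by `0`. -/
theorem indentation_of_le_abs {ε t : ℝ} (hε : 0 < ε) (ht : ε ≤ |t|) : indentation ε t = 0 := by
  have hε' : (ε : ℂ) ≠ 0 := by exact_mod_cast hε.ne'
  unfold indentation
  rcases le_abs.1 ht with h | h
  · rw [min_eq_right h, max_eq_right (by linarith)]
    rw [show Complex.I * Real.pi / (2 * ε) * ε = Real.pi / 2 * Complex.I by field_simp,
      Complex.exp_pi_div_two_mul_I]
    ring
  · rw [min_eq_left (by linarith), max_eq_left (by linarith)]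
    rw [show Complex.I * Real.pi / (2 * ε) * ((-ε : ℝ) : ℂ) = -(Real.pi / 2 * Complex.I) by
      push_cast; field_simp, Complex.exp_neg, Complex.exp_pi_div_two_mul_I, Complex.inv_I]
    push_cast
    ring

/-- Since the poles are more than `2ε` apart, at most one indentation is active at each `ω`. The
curve is therefore the axis plus a finite sum of continuous deviations. -/
theorem continuous_indentedAxis {n : ℕ} {P : LTISystem n 1 1} (hW : P.poleFrequencies.Finite)
    {ε : ℝ} (hε : 0 < ε)
    (hsep : ∀ x ∈ P.poleFrequencies, ∀ y ∈ P.poleFrequencies, x ≠ y → 2 * ε < |x - y|) :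
    Continuous (P.indentedAxis ε) := by
  have h : P.indentedAxis ε = fun ω => Complex.I * ω +
      ∑ ω₀ ∈ hW.toFinset, indentation ε (ω - ω₀) := by
    funext ω
    by_cases hω : ∃ ω₀ : ℝ, IsPole P.transferFunction (Complex.I * ω₀) ∧ |ω - ω₀| < ε
    · rw [indentedAxis, dif_pos hω]
      obtain ⟨h1, h2⟩ := hω.choose_spec
      set ω₀ := hω.choose
      rw [Finset.sum_eq_single ω₀]
      · have h3 := abs_lt.1 h2
        rw [indentation, min_eq_left h3.2.le, max_eq_right h3.1.le]
        push_cast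
        ring
      · intro x hx hne
        refine indentation_of_le_abs hε ?_
        have h4 := hsep x (hW.mem_toFinset.1 hx) ω₀ h1 hne
        have h5 := abs_sub_le x ω ω₀
        rw [abs_sub_comm x ω] at h5
        linarith
      · exact fun h6 => absurd (hW.mem_toFinset.2 h1) h6
    · rw [indentedAxis, dif_neg hω, Finset.sum_eq_zero, add_zero]
      intro x hx
      refine indentation_of_le_abs hε (not_lt.1 fun h1 => hω ⟨x, hW.mem_toFinset.1 hx, h1⟩)
  rw [h]
  have := continuous_indentation ε
  fun_prop

end LTISystem

/-! ### The Nyquist criterion -/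

/-- The product of the linear factors of a complex polynomial along a curve winds around the origin
clockwise, once for every root to the right of the curve. -/
theorem isWindingNumber_prod_axisFactor {z : ℝ → ℂ} (hz : Continuous z) (hre : ∀ ω, 0 ≤ (z ω).re)
    (hinf : ∀ᶠ ω in cocompact ℝ, z ω = Complex.I * ω) {s : Multiset ℂ}
    (hleft : ∀ a ∈ s, a.re ≤ 0 → ∀ ω, z ω ≠ a) (hright : ∀ a ∈ s, 0 < a.re → ∀ ω, (z ω).re < a.re) :
    IsWindingNumber (fun ω => (s.map fun a => axisFactor z a ω).prod) 0 (-(rhpCount s : ℤ)) := by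
  rw [← sum_map_neg_ite_eq_neg_rhpCount]
  refine IsWindingNumber.multiset_prod s (axisFactor z) _ fun a ha => ?_
  split_ifs with h
  · exact isWindingNumber_axisFactor_right hz hre hinf (hright a ha h)
  · exact isWindingNumber_axisFactor_left hz hre hinf (not_lt.1 h) (hleft a ha (not_lt.1 h))

theorem prod_axisFactor_coe (z : ℝ → ℂ) (s : Multiset ℂ) (ω : ℝ) :
    (s.map fun a => axisFactor z a ω).prod =
      (s.map fun a => z ω - a).prod / (z ω + 1) ^ s.card := by
  simp only [axisFactor_coe, Multiset.prod_map_div, Multiset.map_const', Multiset.prod_replicate]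

namespace LTISystem

/-- The numerator `q - σ p` of `H - σ`. -/
def shiftedNumerator {n : ℕ} (P : LTISystem n 1 1) (σ : ℂ) : Polynomial ℂ :=
  P.numerator.map Complex.ofRealHom - Polynomial.C σ * P.denominator.map Complex.ofRealHom

theorem eval_shiftedNumerator {n : ℕ} (P : LTISystem n 1 1) (σ z : ℂ) :
    (P.shiftedNumerator σ).eval z = (P.numerator.map Complex.ofRealHom).eval z -
      σ * (P.denominator.map Complex.ofRealHom).eval z := by
  simp [shiftedNumerator]

theorem degree_shiftedNumerator {n : ℕ} (P : LTISystem n 1 1) {σ : ℂ} (hσ : σ ≠ 0) :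
    (P.shiftedNumerator σ).natDegree = n ∧ (P.shiftedNumerator σ).leadingCoeff = -σ := by
  have hC : (Polynomial.C (-σ) * P.denominator.map Complex.ofRealHom).degree =
      P.denominator.degree := by
    rw [Polynomial.degree_C_mul (neg_ne_zero.2 hσ), Polynomial.degree_map]
  have hlt : (P.numerator.map Complex.ofRealHom).degree <
      (Polynomial.C (-σ) * P.denominator.map Complex.ofRealHom).degree := by
    rw [hC, Polynomial.degree_map]
    exact P.degree_numerator_lt
  have heq : P.shiftedNumerator σ = P.numerator.map Complex.ofRealHom +
      Polynomial.C (-σ) * P.denominator.map Complex.ofRealHom := by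
    rw [shiftedNumerator, Polynomial.C_neg]
    ring
  rw [heq, Polynomial.leadingCoeff_add_of_degree_lt hlt, Polynomial.natDegree,
    Polynomial.degree_add_eq_right_of_degree_lt hlt, hC]
  refine ⟨P.natDegree_denominator, ?_⟩
  rw [Polynomial.leadingCoeff_mul, Polynomial.leadingCoeff_C, P.map_denominator_monic.leadingCoeff,
    mul_one]

theorem shiftedNumerator_ne_zero {n : ℕ} (P : LTISystem n 1 1) {σ : ℂ} (hσ : σ ≠ 0) :
    P.shiftedNumerator σ ≠ 0 := fun h => by
  have := (P.degree_shiftedNumerator hσ).2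
  rw [h, Polynomial.leadingCoeff_zero] at this
  exact hσ (neg_eq_zero.1 this.symm)

/-- The winding number of an indented Nyquist contour, for a sufficiently small indentation. -/
theorem IsMinimal.isWindingNumber_nyquistContour {n : ℕ} {P : LTISystem n 1 1} (hP : P.IsMinimal)
    {σ : ℂ} (hσ : σ ≠ 0) {ε : ℝ} (hε : 0 < ε)
    (hsep : ∀ x ∈ P.poleFrequencies, ∀ y ∈ P.poleFrequencies, x ≠ y → 2 * ε < |x - y|)
    (hp : ∀ a ∈ (P.denominator.map Complex.ofRealHom).roots, 0 < a.re → ε < a.re)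
    (hr : ∀ a ∈ (P.shiftedNumerator σ).roots, 0 < a.re → ε < a.re)
    (hr0 : ∀ a ∈ (P.shiftedNumerator σ).roots, a.re ≠ 0) :
    IsWindingNumber (P.nyquistContour ε) σ
      (P.numUnstablePoles - rhpCount (P.shiftedNumerator σ).roots) := by
  rw [hP.numUnstablePoles_eq]
  have hp0 := P.map_denominator_monic.ne_zero
  have hfin := hP.finite_poleFrequencies
  have hz := continuous_indentedAxis hfin hε hsep
  have hre := P.indentedAxis_re_nonneg hε
  have hinf := eventually_indentedAxis_eq hfin ε
  -- A point of the curve with real part `≤ 0` lies on the axis at distance at least `ε` from every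
  -- pole.
  have hne : ∀ ω, ∀ a ∈ (P.denominator.map Complex.ofRealHom).roots, a.re ≤ 0 →
      P.indentedAxis ε ω ≠ a := by
    intro ω a ha har h
    rcases P.indentedAxis_cases hε ω with ⟨h1, h2⟩ | h1
    · have hpole : ω ∈ P.poleFrequencies := by
        refine (hP.isPole_iff _).2 ?_
        rw [← h1, h]
        exact (Polynomial.mem_roots hp0).1 ha
      have := h2 ω hpole
      rw [sub_self, abs_zero] at this
      linarith
    · rw [h] at h1
      linarith
  have hwp := isWindingNumber_prod_axisFactor hz hre hinf
    (s := (P.denominator.map Complex.ofRealHom).roots) (fun a ha har ω => hne ω a ha har)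
    fun a ha har ω => (P.indentedAxis_re_le hε ω).trans_lt (hp a ha har)
  have hwr := isWindingNumber_prod_axisFactor hz hre hinf
    (s := (P.shiftedNumerator σ).roots) (fun a ha har ω h => by
      have h1 := hre ω
      rw [h] at h1
      exact hr0 a ha (le_antisymm har h1))
    fun a ha har ω => (P.indentedAxis_re_le hε ω).trans_lt (hr a ha har)
  -- Both products have `n` factors, so the powers of `z + 1` cancel in the quotient; the constant
  -- `-σ` is the leading coefficient of `q - σ p`.
  have hw := ((IsWindingNumber.const (neg_ne_zero.2 hσ)).mul hwr).mul hwp.inv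
  rw [IsWindingNumber.sub_iff]
  convert hw using 1
  · funext ω
    induction ω with
    | bot => simp [nyquistContour]
    | top => simp [nyquistContour]
    | coe ω =>
      have hpz : (P.denominator.map Complex.ofRealHom).eval (P.indentedAxis ε ω) ≠ 0 := by
        intro h0
        have hmem : P.indentedAxis ε ω ∈ (P.denominator.map Complex.ofRealHom).roots :=
          (Polynomial.mem_roots hp0).2 h0
        rcases le_or_gt (P.indentedAxis ε ω).re 0 with h | h
        · exact hne ω _ hmem h rfl
        · exact ((P.indentedAxis_re_le hε ω).trans_lt (hp _ hmem h)).false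
      have hγ : P.nyquistContour ε ω - σ = (P.shiftedNumerator σ).eval (P.indentedAxis ε ω) /
          (P.denominator.map Complex.ofRealHom).eval (P.indentedAxis ε ω) := by
        rw [nyquistContour, if_neg (by simp), EReal.toReal_coe, transferFunction_eq,
          eval_shiftedNumerator]
        field_simp
      have hs1 := IsAlgClosed.splits (P.shiftedNumerator σ)
      have hs2 := IsAlgClosed.splits (P.denominator.map Complex.ofRealHom)
      have hpow : (P.indentedAxis ε ω + 1) ^ n ≠ 0 :=
        pow_ne_zero _ (add_one_ne_zero_of_re_nonneg (hre ω))
      rw [hγ, prod_axisFactor_coe, prod_axisFactor_coe, ← hs1.natDegree_eq_card_roots,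
        ← hs2.natDegree_eq_card_roots, (P.degree_shiftedNumerator hσ).1, Polynomial.natDegree_map,
        natDegree_denominator, hs1.eval_eq_prod_roots, (P.degree_shiftedNumerator hσ).2,
        hs2.eval_eq_prod_roots_of_monic P.map_denominator_monic]
      rw [hs2.eval_eq_prod_roots_of_monic P.map_denominator_monic] at hpz
      field_simp
  · ring

/-- The **Nyquist criterion** for a minimal system. -/
theorem IsMinimal.mem_stableNyquistRegion_iff {n : ℕ} {P : LTISystem n 1 1} (hP : P.IsMinimal)
    {σ : ℂ} (hσ : σ ≠ 0) :
    σ ∈ P.stableNyquistRegion ↔ ∀ a ∈ (P.shiftedNumerator σ).roots, a.re < 0 := by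
  have hfin := hP.finite_poleFrequencies
  have hr := P.shiftedNumerator_ne_zero hσ
  have hsmall : ∀ {c : ℝ}, 0 < c → ∀ᶠ ε in 𝓝[>] (0 : ℝ), ε < c := fun hc =>
    mem_of_superset (Ioo_mem_nhdsGT hc) fun _ h => h.2
  have hroots : ∀ s : Multiset ℂ, ∀ᶠ ε in 𝓝[>] (0 : ℝ), ∀ a ∈ s, 0 < a.re → ε < a.re := by
    intro s
    have : ∀ᶠ ε in 𝓝[>] (0 : ℝ), ∀ a ∈ s.toFinset, 0 < a.re → ε < a.re := by
      rw [Filter.eventually_all_finset]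
      intro a _
      by_cases h : 0 < a.re
      · exact (hsmall h).mono fun _ hε _ => hε
      · exact .of_forall fun _ h' => absurd h' h
    simpa using this
  have hsep : ∀ᶠ ε in 𝓝[>] (0 : ℝ), ∀ x ∈ P.poleFrequencies, ∀ y ∈ P.poleFrequencies,
      x ≠ y → 2 * ε < |x - y| := by
    rw [hfin.eventually_all]
    intro x _
    rw [hfin.eventually_all]
    intro y _
    by_cases h : x = y
    · exact .of_forall fun _ h' => absurd h h'
    · filter_upwards [hsmall (half_pos (abs_pos.2 (sub_ne_zero.2 h)))] with ε hε _
      linarith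
  have hwind : (∀ a ∈ (P.shiftedNumerator σ).roots, a.re ≠ 0) → ∀ᶠ ε in 𝓝[>] (0 : ℝ),
      IsWindingNumber (P.nyquistContour ε) σ
        (P.numUnstablePoles - rhpCount (P.shiftedNumerator σ).roots) := by
    intro h0
    filter_upwards [hsep, hroots (P.denominator.map Complex.ofRealHom).roots,
      hroots (P.shiftedNumerator σ).roots, self_mem_nhdsWithin] with ε h1 h2 h3 hε
    exact hP.isWindingNumber_nyquistContour hσ hε h1 h2 h3 h0
  constructor
  · rintro ⟨v, hv, hlim⟩
    -- By coprimality an imaginary root `a` of `q - σ p` is not a pole. Small indentations miss it,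
    -- and the contour takes the value `σ` there.
    have h0 : ∀ a ∈ (P.shiftedNumerator σ).roots, a.re ≠ 0 := by
      intro a ha har
      have hev := (Polynomial.mem_roots hr).1 ha
      rw [Polynomial.IsRoot, eval_shiftedNumerator] at hev
      have haI : a = Complex.I * (a.im : ℂ) := Complex.ext (by simpa using har) (by simp)
      have hpa : (P.denominator.map Complex.ofRealHom).eval a ≠ 0 := by
        intro h
        obtain ⟨u, w, huw⟩ := hP.isCoprime_map
        rw [h, mul_zero, sub_zero] at hev
        simpa [h, hev] using congrArg (Polynomial.eval a) huw
      have hfar : ∀ᶠ ε in 𝓝[>] (0 : ℝ), ∀ ω₀ ∈ P.poleFrequencies, ε < |a.im - ω₀| := by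
        rw [hfin.eventually_all]
        intro ω₀ hω₀
        refine hsmall (abs_pos.2 (sub_ne_zero.2 fun h => hpa ?_))
        rw [haI, h]
        exact (hP.isPole_iff _).1 hω₀
      obtain ⟨ε, hε, hw⟩ := (hfar.and hv).exists
      refine hw.2.2.1 (a.im : ℝ) ?_
      rw [nyquistContour, if_neg (by simp), EReal.toReal_coe,
        P.indentedAxis_of_forall_le fun ω₀ h => (hε ω₀ h).le, ← haI, transferFunction_eq,
        div_eq_iff hpa]
      exact sub_eq_zero.1 hev
    -- Convergence in `ℤ` means being eventually constant, so some single `ε` realizes the limit.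
    rw [nhds_discrete, tendsto_pure] at hlim
    obtain ⟨ε, ⟨h1, h2⟩, h3⟩ := ((hwind h0).and hv |>.and hlim).exists
    have hcount : rhpCount (P.shiftedNumerator σ).roots = 0 := by
      have := h1.unique h2
      omega
    intro a ha
    refine lt_of_le_of_ne (not_lt.1 fun hpos => ?_) (h0 a ha)
    rw [rhpCount, Multiset.card_eq_zero, Multiset.filter_eq_nil] at hcount
    exact hcount a ha hpos
  · intro h
    have hcount : rhpCount (P.shiftedNumerator σ).roots = 0 := by
      rw [rhpCount, Multiset.card_eq_zero, Multiset.filter_eq_nil]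
      exact fun a ha => (h a ha).not_gt
    have := hwind fun a ha => (h a ha).ne
    rw [hcount, Nat.cast_zero, sub_zero] at this
    exact ⟨_, this, tendsto_const_nhds⟩

/-! ### The synchronization region -/

theorem mem_syncRegion_iff {n : ℕ} (P : LTISystem n 1 1) {k : ℝ} (hk : k ≠ 0) {σ : ℂ}
    (hσ : σ ≠ 0) : -1 / (σ * (k : ℂ)) ∈ P.syncRegion !![k] ↔
      ∀ a ∈ (P.shiftedNumerator σ).roots, a.re < 0 := by
  have hkC : (k : ℂ) ≠ 0 := by exact_mod_cast hk
  have hM : (-1 / (σ * (k : ℂ))) • (P.B * !![k] * P.C).map Complex.ofReal =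
      (-1 / σ) • (P.B.map Complex.ofReal * P.C.map Complex.ofReal) := by
    ext i j
    simp [Matrix.mul_apply]
    field_simp
  have hpoly : Polynomial.C (-1 / σ) * P.shiftedNumerator σ = (P.A.map Complex.ofReal -
      (-1 / σ) • (P.B.map Complex.ofReal * P.C.map Complex.ofReal)).charpoly := by
    have hC : Polynomial.C (-1 / σ) * Polynomial.C σ = (-1 : Polynomial ℂ) := by
      rw [← Polynomial.C_mul, div_mul_cancel₀ _ hσ]
      simp
    rw [charpoly_closedLoop, shiftedNumerator]
    linear_combination (-P.denominator.map Complex.ofRealHom) * hC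
  rw [syncRegion, Set.mem_ofPred_eq, hM, IsHurwitz]
  refine forall_congr' fun a => imp_congr_left ?_
  rw [Matrix.mem_spectrum_iff_isRoot_charpoly, ← hpoly,
    Polynomial.mem_roots (P.shiftedNumerator_ne_zero hσ), Polynomial.IsRoot, Polynomial.eval_mul,
    Polynomial.eval_C, Polynomial.IsRoot]
  simp [hσ]

end LTISystem
end

theorem mainTheorem9 {n : ℕ} (P : LTISystem n 1 1) (hP : P.IsMinimal) (k : ℝ) (hk : k ≠ 0) :
    P.syncRegion !![k] \ {0} =
      {z : ℂ | ∃ s ∈ P.stableNyquistRegion \ {0}, z = -1 / (s * (k : ℂ))} := by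
  have hkC : (k : ℂ) ≠ 0 := by exact_mod_cast hk
  ext z
  simp only [Set.mem_sdiff, Set.mem_singleton_iff, Set.mem_ofPred_eq]
  constructor
  · rintro ⟨hz, hz0⟩
    have hσ : -1 / (z * (k : ℂ)) ≠ 0 := div_ne_zero (by simp) (mul_ne_zero hz0 hkC)
    -- The map `z ↦ -1/(zk)` is an involution on the nonzero complex numbers.
    have hzσ : z = -1 / (-1 / (z * (k : ℂ)) * (k : ℂ)) := by
      field_simp
    refine ⟨_, ⟨?_, hσ⟩, hzσ⟩
    rw [hP.mem_stableNyquistRegion_iff hσ, ← P.mem_syncRegion_iff hk hσ, ← hzσ]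
    exact hz
  · rintro ⟨σ, ⟨hσN, hσ⟩, rfl⟩
    refine ⟨?_, div_ne_zero (by simp) (mul_ne_zero hσ hkC)⟩
    rw [P.mem_syncRegion_iff hk hσ, ← hP.mem_stableNyquistRegion_iff hσ]
    exact hσN
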